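/- Let $d\ge 2$ and $N\ge 1$ be integers, let $\mathbb T^d=(\mathbb R/\mathbb Z)^d$ with the distance $\|s-t\|_{\mathbb T^d}=\min_{j\in\mathbb Z^d}\|s-t+j\|_\infty$, and put $q=\sqrt d/N$. Let $Y\subset\mathbb T^d$ be a nonempty finite set which is the disjoint union of nonempty sets (clusters) $\Lambda_1,\dots,\Lambda_r$, each of which has at most two points and is contained in a closed axis-parallel cube of side length $q$. Assume that the minimal separation satisfies $$\operatorname{sep} Y:=\min_{t_1,t_2\in Y,\ t_1\ne t_2}\|t_1-t_2\|_{\mathbb T^d}\ \ge\ \tau\quad\text{for some } \tau\in\Bigl(0,\frac{\sqrt d}{N}\Bigr),$$ and that the minimal cluster separation satisfies $$\Delta:=\min_{i\ne j}\ \min_{y_1\in\Lambda_i,\ y_2\in\Lambda_j}\|y_1-y_2\|_{\mathbb T^d}\ \ge\ 2q=\frac{2\sqrt d}{N}$$ (minima over the empty set are $+\infty$). Then the smallest of the $|Y|$ singular values (the square roots of the eigenvalues of $\mathscr A^*\mathscr A$, with multiplicity) of the Vandermonde matrix $$\mathscr A=\bigl(e^{-2\pi i\, t\cdot k}\bigr)_{k\in\mathbb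 Z^d,\ \|k\|_2\le N;\ t\in Y}$$ satisfies $$\sigma_{\min}(\mathscr A)\ \ge\ \sqrt{\frac{d-\frac12}{3d^2}}\,\Bigl(\frac32\Bigr)^{d/2}\,\frac{(N\tau)\,N^{d/2}}{2^{-1/2}\,d^{d/4}}.$$ In particular, all these singular values are non-zero. -/

import Mathlib

open scoped ENNReal

noncomputable section

namespace Vandermonde

/- The torus `𝕋^d = (ℝ/ℤ)^d` is `UnitAddTorus (Fin d)`, i.e. `Fin d → ℝ/ℤ`.  The norm of `ℝ/ℤ` is the
distance to the nearest integer and functions on `Fin d` carry the maximum norm, so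
`dist s t = min_{j ∈ ℤ^d} ‖s - t + j‖_∞`.  The minimal separation `sep Y` is Mathlib's
`Set.einfsep Y`, which is `∞` if `Y` has at most one point. -/

/-- The `ℓ²`-ball of radius `N` in `ℤ^d`. -/
def freqBallSet (d N : ℕ) : Set (Fin d → ℤ) :=
  {k | ‖WithLp.toLp 2 (fun i => (k i : ℝ))‖ ≤ (N : ℝ)}

theorem finite_freqBallSet (d N : ℕ) : (freqBallSet d N).Finite := by
  refine (Set.finite_Icc (fun _ : Fin d => -(N : ℤ)) (fun _ => (N : ℤ))).subset ?_
  intro k hk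
  have h : ∀ i, |k i| ≤ (N : ℤ) := by
    intro i
    have h1 := (PiLp.norm_apply_le (WithLp.toLp 2 (fun i => (k i : ℝ))) i).trans hk
    have h2 : |(k i : ℝ)| ≤ (N : ℝ) := by simpa using h1
    exact_mod_cast h2
  exact ⟨fun i => (abs_le.mp (h i)).1, fun i => (abs_le.mp (h i)).2⟩

/-- The same ball as a finite set; it indexes the rows of the Vandermonde matrix. -/
def freqBall (d N : ℕ) : Finset (Fin d → ℤ) := (finite_freqBallSet d N).toFinset

/-- The Vandermonde matrix `(e^{-2πi t·k})` with rows `k ∈ ℤ^d`, `‖k‖₂ ≤ N`, and columns `t ∈ Y`. -/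
def vandermondeMatrix {d : ℕ} (N : ℕ) (Y : Finset (UnitAddTorus (Fin d))) :
    Matrix (freqBall d N) Y ℂ :=
  Matrix.of fun k t => UnitAddTorus.mFourier (-(k : Fin d → ℤ)) (t : UnitAddTorus (Fin d))

/-- At a point of the torus represented by `x ∈ ℝ^d`, the character used above is
`e^{-2πi x·k}`. -/
theorem mFourier_neg_coe {d : ℕ} (k : Fin d → ℤ) (x : Fin d → ℝ) :
    UnitAddTorus.mFourier (-k) (fun i => (x i : UnitAddCircle)) =
      Complex.exp (-2 * Real.pi * Complex.I * ∑ i, (x i : ℂ) * (k i : ℂ)) := by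
  simp only [UnitAddTorus.mFourier, ContinuousMap.coe_mk, fourier_coe_apply, Finset.mul_sum,
    Complex.exp_sum]
  refine Finset.prod_congr rfl fun i _ => ?_
  congr 1
  simp only [Pi.neg_apply]
  push_cast
  ring

/-- The smallest singular value of a matrix with column index set `n ≠ ∅`: the last one of its
`|n|` singular values (square roots of the eigenvalues of `Aᴴ A`, in descending order with
multiplicities, numbered from `0`). -/
def sigmaMin {m n : Type*} [Fintype m] [Fintype n] [DecidableEq n] (A : Matrix m n ℂ) : ℝ :=
  (Matrix.toEuclideanLin A).singularValues (Fintype.card n - 1)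

/-- `Λ` is contained in (the image in the torus of) a closed axis-parallel cube of side
length `q`. -/
def InCube {d : ℕ} (q : ℝ) (Λ : Set (UnitAddTorus (Fin d))) : Prop :=
  ∃ a : Fin d → ℝ, Λ ⊆ (fun (x : Fin d → ℝ) (i : Fin d) => (x i : UnitAddCircle)) ''
    Set.Icc a (fun i => a i + q)

/-- `C` is a decomposition of `Y` into clusters of at most two nodes: the sets in `C` are nonempty,
pairwise disjoint, have union `Y`, and each of them has at most two points and lies in a cube of
side length `q`. -/
structure IsPairClustering {d : ℕ} (q : ℝ) (Y : Set (UnitAddTorus (Fin d)))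
    (C : Set (Set (UnitAddTorus (Fin d)))) : Prop where
  sUnion_eq : ⋃₀ C = Y
  pairwiseDisjoint : C.PairwiseDisjoint id
  nonempty : ∀ Λ ∈ C, Λ.Nonempty
  inCube : ∀ Λ ∈ C, InCube q Λ
  card_le_two : ∀ Λ ∈ C, Λ.encard ≤ 2

/-- The distance between two clusters. -/
def clusterDist {d : ℕ} (Λ₁ Λ₂ : Set (UnitAddTorus (Fin d))) : ℝ≥0∞ :=
  ⨅ y₁ ∈ Λ₁, ⨅ y₂ ∈ Λ₂, edist y₁ y₂

/-- The minimal cluster separation `Δ`, the least distance between two different clusters (`∞` if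
there is at most one cluster). -/
def clusterSep {d : ℕ} (C : Set (Set (UnitAddTorus (Fin d)))) : ℝ≥0∞ :=
  ⨅ Λ₁ ∈ C, ⨅ Λ₂ ∈ C, ⨅ _ : Λ₁ ≠ Λ₂, clusterDist Λ₁ Λ₂

end Vandermonde

end

/-! Write q = √d/N. If real weights w satisfy w ≤ 1 on the frequency ball and w ≤ 0 off it, then
‖𝒜c‖² is at least the quadratic form with entries W(t' - t), where W(x) = Σ_k w(k) e^{2πi k·x}. If W
vanishes at differences between distinct clusters, each row has at most one nonzero off-diagonal
entry, and diagonal dominance leaves only |W(x)| ≤ W(0) - b² to be shown for differences x of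
distinct nodes (`le_sigmaMin_vandermondeMatrix`, `sum_norm_le_of_isPairClustering`).

For q ≤ 1/2 take w(k) = ∏ φ̂(q k_j) · (1 - ‖k‖₂²/N²), φ being the even extension of `bump` by zero.
Since φ is an autocorrelation of integral one, 0 ≤ φ̂ ≤ 1, and the last factor supplies the sign.
Because q²/d = 1/N², that factor is the average over i of 1 - (q k_i)², which amounts to replacing
`bump` by `bumpLap` in direction i. So W is `kernel`, which vanishes for ‖x‖ ≥ q (`hasSum_kernel`,
`kernel_eq_zero`), and its quadratic drop away from the origin (`kernel_le`) is the claimed bound.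

For q > 1/2 the kernel does not fit into one period, but the cluster separation 2q exceeds every
distance in the torus, so there is one cluster. Now w is the indicator of the ball and W its
Dirichlet kernel; pairing neighbouring frequencies k and k + e_i gives enough cancellation
(`norm_sum_mFourier_le`, `three_halves_div_pow_le`). -/

namespace Vandermonde

open Real intervalIntegral

/-! ### One-dimensional profiles and their pointwise inequalities. -/

/-- The autocorrelation of `cos²(π·)` on `[-1/2, 1/2]`, normalised to have integral one, on
`[0, 1]`. -/
noncomputable def bump (s : ℝ) : ℝ :=
  (1 - s) * (1 + cos (2 * π * s) / 2) + 3 / (4 * π) * sin (2 * π * s)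

/-- The function `bump + bump'' / (4π²)`. -/
noncomputable def bumpLap (s : ℝ) : ℝ := (1 - s) + sin (2 * π * s) / (2 * π)

@[fun_prop]
theorem continuous_bump : Continuous bump := by unfold bump; fun_prop

@[fun_prop]
theorem continuous_bumpLap : Continuous bumpLap := by unfold bumpLap; fun_prop

theorem bump_zero : bump 0 = 3 / 2 := by norm_num [bump]

theorem bump_one : bump 1 = 0 := by simp [bump]

theorem bumpLap_zero : bumpLap 0 = 1 := by simp [bumpLap]

theorem bumpLap_one : bumpLap 1 = 0 := by simp [bumpLap]

theorem mul_cos_le_sin {x : ℝ} (h0 : 0 ≤ x) (h1 : x ≤ π) : x * cos x ≤ sin x := by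
  rcases lt_or_ge x (π / 2) with h | h
  · have hc : 0 < cos x := cos_pos_of_mem_Ioo ⟨by linarith [pi_pos], h⟩
    have := le_tan h0 h
    rwa [tan_eq_sin_div_cos, le_div_iff₀ hc] at this
  · have hc : cos x ≤ 0 := cos_nonpos_of_pi_div_two_le_of_le h (by linarith)
    nlinarith [sin_nonneg_of_nonneg_of_le_pi h0 h1]

/-- The difference of the sides vanishes at 0 and has derivative 4 sin(x/2) (sin(x/2) - (x/2)
cos(x/2)) ≥ 0. With v = 2π(1 - s) this yields `bump_nonneg`. -/
theorem three_mul_sin_le {v : ℝ} (h0 : 0 ≤ v) (h1 : v ≤ 2 * π) : 3 * sin v ≤ v * (2 + cos v) := by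
  have hd : ∀ x : ℝ, HasDerivAt (fun x => x * (2 + cos x) - 3 * sin x)
      (1 * (2 + cos x) + x * (-sin x) - 3 * cos x) x := fun x =>
    ((hasDerivAt_id x).mul ((hasDerivAt_cos x).const_add 2)).sub ((hasDerivAt_sin x).const_mul 3)
  have hm : MonotoneOn (fun x => x * (2 + cos x) - 3 * sin x) (Set.Icc 0 (2 * π)) := by
    refine monotoneOn_of_deriv_nonneg (convex_Icc _ _) (by fun_prop)
      (fun x _ => (hd x).differentiableAt.differentiableWithinAt) fun x hx => ?_
    rw [interior_Icc] at hx
    rw [(hd x).deriv]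
    have h2 := mul_cos_le_sin (x := x / 2) (by linarith [hx.1]) (by linarith [hx.2])
    have h3 : 0 ≤ sin (x / 2) :=
      sin_nonneg_of_nonneg_of_le_pi (by linarith [hx.1]) (by linarith [hx.2])
    have hc : cos x = 1 - 2 * sin (x / 2) ^ 2 := by
      have := cos_two_mul (x / 2)
      rw [cos_sq', mul_div_cancel₀ _ two_ne_zero] at this
      linarith
    have hs : sin x = 2 * sin (x / 2) * cos (x / 2) := by
      rw [← sin_two_mul]; congr 1; ring
    rw [hc, hs]
    nlinarith [mul_nonneg h3 (sub_nonneg.2 h2)]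
  have := hm ⟨le_rfl, by positivity⟩ ⟨h0, h1⟩ h0
  simp at this
  linarith

theorem bump_nonneg {s : ℝ} (h0 : 0 ≤ s) (h1 : s ≤ 1) : 0 ≤ bump s := by
  have hp := pi_pos
  have h := three_mul_sin_le (v := 2 * π * (1 - s)) (by nlinarith) (by nlinarith)
  have e1 : sin (2 * π * (1 - s)) = - sin (2 * π * s) := by
    rw [mul_one_sub, sin_two_pi_sub]
  have e2 : cos (2 * π * (1 - s)) = cos (2 * π * s) := by
    rw [mul_one_sub, cos_two_pi_sub]
  rw [e1, e2] at h
  have : bump s = (2 * π * (1 - s) * (2 + cos (2 * π * s)) - 3 * -sin (2 * π * s)) / (4 * π) := by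
    unfold bump; field_simp; ring
  rw [this]
  apply div_nonneg <;> linarith

theorem sin_two_pi_mul_le {s : ℝ} (h0 : 0 ≤ s) : sin (2 * π * s) / (2 * π) ≤ s := by
  rw [div_le_iff₀ (by positivity)]
  linarith [sin_le (x := 2 * π * s) (by positivity)]

theorem bumpLap_nonneg {s : ℝ} (h1 : s ≤ 1) : 0 ≤ bumpLap s := by
  have h := sin_two_pi_mul_le (s := 1 - s) (by linarith)
  rw [mul_one_sub, sin_two_pi_sub, neg_div] at h
  unfold bumpLap; linarith

theorem bumpLap_le_one {s : ℝ} (h0 : 0 ≤ s) : bumpLap s ≤ 1 := by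
  have h := sin_two_pi_mul_le h0
  unfold bumpLap; linarith

theorem cos_two_pi_mul (s : ℝ) : cos (2 * π * s) = 1 - 2 * sin (π * s) ^ 2 := by
  rw [mul_assoc, cos_two_mul, cos_sq']; ring

theorem four_mul_sq_le_sin_sq {s : ℝ} (h0 : 0 ≤ s) (h1 : s ≤ 1 / 2) :
    4 * s ^ 2 ≤ sin (π * s) ^ 2 := by
  have h := mul_le_sin (x := π * s) (by positivity) (by nlinarith [pi_pos])
  have e : 2 / π * (π * s) = 2 * s := by field_simp
  rw [e] at h
  nlinarith

theorem sin_two_pi_mul_nonpos {s : ℝ} (h0 : 1 / 2 ≤ s) (h1 : s ≤ 1) : sin (2 * π * s) ≤ 0 := by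
  have h := sin_nonneg_of_nonneg_of_le_pi (x := 2 * π * (1 - s)) (by nlinarith [pi_pos])
    (by nlinarith [pi_pos])
  rw [mul_one_sub, sin_two_pi_sub] at h
  linarith

theorem bump_le {s : ℝ} (h0 : 0 ≤ s) (h1 : s ≤ 1) : bump s ≤ 3 / 2 * (1 - s ^ 2) := by
  have e : bump s = (1 - s) * (3 / 2 - sin (π * s) ^ 2) + 3 / 2 * (sin (2 * π * s) / (2 * π)) := by
    unfold bump; rw [cos_two_pi_mul]; field_simp; ring
  rw [e]
  rcases le_or_gt (1 / 2) s with h | h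
  · have := sin_two_pi_mul_nonpos h h1
    have h3 : sin (2 * π * s) / (2 * π) ≤ 0 := div_nonpos_of_nonpos_of_nonneg this (by positivity)
    nlinarith [mul_nonneg (sub_nonneg.2 h1) (sq_nonneg (sin (π * s))), mul_nonneg h0 (sub_nonneg.2 h1)]
  · have h2 := four_mul_sq_le_sin_sq h0 h.le
    have h3 := sin_two_pi_mul_le h0
    nlinarith [mul_le_mul_of_nonneg_left h2 (sub_nonneg.2 h1), mul_nonneg (sq_nonneg s) (sub_nonneg.2 h.le)]

theorem bump_le_three_halves {s : ℝ} (h0 : 0 ≤ s) (h1 : s ≤ 1) : bump s ≤ 3 / 2 := by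
  nlinarith [bump_le h0 h1]

/-- Near 0 the drop of `bumpLap` is only cubic, so no quadratic bound with a useful constant holds
for it alone; the surplus in the drop of one `bump` factor pays for it. -/
theorem bump_add_bumpLap_le {s : ℝ} (h0 : 0 ≤ s) (h1 : s ≤ 1) :
    3 / 2 * s ^ 2 ≤ (1 - bumpLap s) + (1 - 2 / 3 * bump s) := by
  have e : (1 - bumpLap s) + (1 - 2 / 3 * bump s) =
      2 * s - sin (2 * π * s) / π + 2 / 3 * ((1 - s) * sin (π * s) ^ 2) := by
    unfold bump bumpLap; rw [cos_two_pi_mul]; field_simp; ring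
  rw [e]
  have h4 : 0 ≤ (1 - s) * sin (π * s) ^ 2 := mul_nonneg (by linarith) (sq_nonneg _)
  rcases le_or_gt (1 / 2) s with h | h
  · have := sin_two_pi_mul_nonpos h h1
    have h3 : sin (2 * π * s) / π ≤ 0 := div_nonpos_of_nonpos_of_nonneg this (by positivity)
    nlinarith
  -- The sine-square term alone suffices while (2/3)(1 - s)·4s² ≥ (3/2)s², that is, for s ≤ 7/16.
  · rcases le_or_gt s (7 / 16) with h5 | h5
    · have h2 := four_mul_sq_le_sin_sq h0 h.le
      have h3 := sin_two_pi_mul_le h0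
      have h6 : sin (2 * π * s) / π = 2 * (sin (2 * π * s) / (2 * π)) := by field_simp
      nlinarith [mul_le_mul_of_nonneg_left h2 (sub_nonneg.2 h1), mul_nonneg (sq_nonneg s) (sub_nonneg.2 h5)]
    · have h6 : sin (2 * π * s) / π ≤ 1 / 2 := by
        rw [div_le_iff₀ pi_pos]
        linarith [sin_le_one (2 * π * s), pi_gt_three]
      nlinarith

/-! ### Cosine transforms -/

/-- The cosine transform of an even function supported on `[-1, 1]`. -/
noncomputable def cosTransform (h : ℝ → ℝ) (y : ℝ) : ℝ :=
  2 * ∫ s in (0 : ℝ)..1, h s * cos (2 * π * y * s)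

/-- Two integrations by parts turn `bump''` into -(2πy)² `bump`; the boundary terms vanish because
`bump'` is zero at 0 and 1 and `bump 1 = 0`. -/
theorem cosTransform_bumpLap (y : ℝ) :
    cosTransform bumpLap y = (1 - y ^ 2) * cosTransform bump y := by
  have key : ∫ s in (0 : ℝ)..1, (bumpLap s - (1 - y ^ 2) * bump s) * cos (2 * π * y * s) = 0 := by
    have hd : ∀ s : ℝ, HasDerivAt (fun s => (1 / (4 * π ^ 2)) *
        ((-1 + cos (2 * π * s) - π * (1 - s) * sin (2 * π * s)) * cos (2 * π * y * s) +
          2 * π * y * bump s * sin (2 * π * y * s)))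
        ((bumpLap s - (1 - y ^ 2) * bump s) * cos (2 * π * y * s)) s := by
      intro s
      have l1 : ∀ a : ℝ, HasDerivAt (fun s : ℝ => a * s) a s := fun a => by
        simpa using (hasDerivAt_id s).const_mul a
      have hc := (l1 (2 * π)).cos
      have hs := (l1 (2 * π)).sin
      have hcy := (l1 (2 * π * y)).cos
      have hsy := (l1 (2 * π * y)).sin
      have hu := (hasDerivAt_id s).const_sub 1
      have hb : HasDerivAt bump (-1 + cos (2 * π * s) - π * (1 - s) * sin (2 * π * s)) s := by
        refine ((hu.mul ((hc.div_const 2).const_add 1)).add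
          (hs.const_mul (3 / (4 * π)))).congr_deriv ?_
        simp only [id]
        field_simp
        ring
      refine ((((((hc.const_add (-1)).sub ((hu.const_mul π).mul hs)).mul hcy).add
        ((hb.const_mul (2 * π * y)).mul hsy)).const_mul (1 / (4 * π ^ 2)))).congr_deriv ?_
      simp only [id, bump, bumpLap, Pi.sub_apply, Pi.mul_apply]
      field_simp
      ring
    rw [integral_eq_sub_of_hasDerivAt (fun s _ => hd s)
      (by apply Continuous.intervalIntegrable; fun_prop)]
    simp [bump_one]
  have e : ∀ s, (bumpLap s - (1 - y ^ 2) * bump s) * cos (2 * π * y * s) =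
      bumpLap s * cos (2 * π * y * s) - (1 - y ^ 2) * (bump s * cos (2 * π * y * s)) := fun s => by
    ring
  simp_rw [e] at key
  rw [integral_sub (by apply Continuous.intervalIntegrable; fun_prop)
    (by apply Continuous.intervalIntegrable; fun_prop), integral_const_mul] at key
  unfold cosTransform
  linarith

/-- The second derivative of `bumpLap` is -2π sin(2πs), so two integrations by parts give an
explicit antiderivative. The polynomial factors stay on the left to avoid dividing at y = 0, ±1. -/
theorem mul_cosTransform_bumpLap (y : ℝ) :
    π ^ 2 * (y ^ 2 * (1 - y ^ 2)) * cosTransform bumpLap y = sin (π * y) ^ 2 := by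
  have hd : ∀ s : ℝ, HasDerivAt (fun s =>
      (1 - y ^ 2) * ((-1 + cos (2 * π * s)) * cos (2 * π * y * s) +
        2 * π * y * bumpLap s * sin (2 * π * y * s)) -
      (cos (2 * π * s) * cos (2 * π * y * s) + y * sin (2 * π * s) * sin (2 * π * y * s)))
      (4 * π ^ 2 * (y ^ 2 * (1 - y ^ 2)) * (bumpLap s * cos (2 * π * y * s))) s := by
    intro s
    have l1 : ∀ a : ℝ, HasDerivAt (fun s : ℝ => a * s) a s := fun a => by
      simpa using (hasDerivAt_id s).const_mul a
    have hc := (l1 (2 * π)).cos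
    have hs := (l1 (2 * π)).sin
    have hcy := (l1 (2 * π * y)).cos
    have hsy := (l1 (2 * π * y)).sin
    have hb : HasDerivAt bumpLap (-1 + cos (2 * π * s)) s := by
      refine (((hasDerivAt_id s).const_sub 1).add (hs.div_const (2 * π))).congr_deriv ?_
      field_simp
    refine (((((hc.const_add (-1)).mul hcy).add
      ((hb.const_mul (2 * π * y)).mul hsy)).const_mul (1 - y ^ 2)).sub
      ((hc.mul hcy).add ((hs.const_mul y).mul hsy))).congr_deriv ?_
    simp only [bumpLap]
    ring
  have key := integral_eq_sub_of_hasDerivAt (a := 0) (b := 1) (fun s _ => hd s)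
      (by apply Continuous.intervalIntegrable; fun_prop)
  rw [integral_const_mul] at key
  simp [bumpLap_one] at key
  have e : cos (2 * π * y) = 1 - 2 * sin (π * y) ^ 2 := cos_two_pi_mul y
  rw [e] at key
  unfold cosTransform
  linarith

/-- The closed form degenerates at 0; there the transforms of `bump` and `bumpLap` agree, and the
latter is integrated directly. -/
theorem cosTransform_bump_zero : cosTransform bump 0 = 1 := by
  have h := cosTransform_bumpLap 0
  have hd : ∀ s : ℝ, HasDerivAt (fun s => s - s ^ 2 / 2 - cos (2 * π * s) / (2 * π) / (2 * π))
      (bumpLap s) s := by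
    intro s
    have l1 : HasDerivAt (fun s : ℝ => 2 * π * s) (2 * π) s := by
      simpa using (hasDerivAt_id s).const_mul (2 * π)
    refine (((hasDerivAt_id s).sub ((hasDerivAt_pow 2 s).div_const 2)).sub
      ((l1.cos.div_const (2 * π)).div_const (2 * π))).congr_deriv ?_
    unfold bumpLap; field_simp; simp; ring
  have key := integral_eq_sub_of_hasDerivAt (a := 0) (b := 1) (fun s _ => hd s)
      (by apply Continuous.intervalIntegrable; fun_prop)
  simp at key
  have h2 : cosTransform bumpLap 0 = 1 := by
    simp [cosTransform, key]; norm_num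
  rw [h2] at h
  simpa using h.symm

theorem abs_cosTransform_bump_le (y : ℝ) : |cosTransform bump y| ≤ 1 := by
  rw [← cosTransform_bump_zero]
  unfold cosTransform
  rw [abs_mul, abs_two]
  refine mul_le_mul_of_nonneg_left ?_ zero_le_two
  rw [← Real.norm_eq_abs]
  refine norm_integral_le_of_norm_le zero_le_one ?_ (by apply Continuous.intervalIntegrable; fun_prop)
  refine Filter.Eventually.of_forall fun s hs => ?_
  have hb := bump_nonneg hs.1.le hs.2
  rw [norm_mul, norm_eq_abs, norm_eq_abs, abs_of_nonneg hb]
  simpa using mul_le_of_le_one_right hb (abs_cos_le_one _)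

theorem continuous_cosTransform_bump : Continuous (cosTransform bump) := by
  unfold cosTransform
  refine continuous_const.mul ?_
  apply intervalIntegral.continuous_parametric_intervalIntegral_of_continuous'
  fun_prop

theorem mul_cosTransform_bump (y : ℝ) :
    (π * y * (1 - y ^ 2)) ^ 2 * cosTransform bump y = sin (π * y) ^ 2 := by
  rw [← mul_cosTransform_bumpLap, cosTransform_bumpLap]; ring

/-- `mul_cosTransform_bump` exhibits the transform as a quotient of squares off {0, 1, -1};
continuity covers these three points. -/
theorem cosTransform_bump_nonneg (y : ℝ) : 0 ≤ cosTransform bump y := by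
  refine ge_of_tendsto (x := nhdsWithin y {y}ᶜ)
    (continuous_cosTransform_bump.continuousAt.tendsto.mono_left nhdsWithin_le_nhds) ?_
  have hfin : ({0, 1, -1} : Set ℝ).Finite := by simp
  have : ({0, 1, -1} \ {y} : Set ℝ)ᶜ ∈ nhds y :=
    (hfin.subset Set.sdiff_subset).isClosed.isOpen_compl.mem_nhds (by simp)
  filter_upwards [mem_nhdsWithin_of_mem_nhds this, self_mem_nhdsWithin] with z hz hzy
  have hz' : z ≠ 0 ∧ z ≠ 1 ∧ z ≠ -1 := by
    have hzy : z ≠ y := hzy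
    simp only [Set.mem_compl_iff, Set.mem_sdiff, Set.mem_insert_iff, Set.mem_singleton_iff] at hz
    tauto
  have hne : π * z * (1 - z ^ 2) ≠ 0 := by
    refine mul_ne_zero (mul_ne_zero pi_ne_zero hz'.1) ?_
    have : (1 - z ^ 2) = (1 - z) * (1 - -z) := by ring
    rw [this]
    refine mul_ne_zero (sub_ne_zero.2 (Ne.symm hz'.2.1)) (sub_ne_zero.2 fun h => hz'.2.2 ?_)
    linarith
  have h := mul_cosTransform_bump z
  by_contra hlt
  have h3 : 0 < (π * z * (1 - z ^ 2)) ^ 2 := by positivity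
  nlinarith [mul_neg_of_pos_of_neg h3 (not_le.1 hlt), sq_nonneg (sin (π * z))]

theorem abs_cosTransform_bumpLap_le {y : ℝ} (hy : 2 ≤ |y|) :
    |cosTransform bumpLap y| ≤ 1 / y ^ 2 := by
  have hy2 : 4 ≤ y ^ 2 := by rw [← sq_abs]; nlinarith
  have h := congrArg abs (mul_cosTransform_bumpLap y)
  rw [abs_mul, abs_mul, abs_mul, abs_of_nonneg (sq_nonneg π), abs_of_nonneg (sq_nonneg y),
    abs_of_nonneg (sq_nonneg (sin _)), abs_of_nonpos (by linarith : 1 - y ^ 2 ≤ 0)] at h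
  have h1 := sin_sq_le_one (π * y)
  rw [le_div_iff₀ (by positivity)]
  have h2 : 1 ≤ π ^ 2 * -(1 - y ^ 2) := by nlinarith [pi_gt_three]
  nlinarith [mul_le_mul_of_nonneg_right h2 (mul_nonneg (abs_nonneg (cosTransform bumpLap y)) (sq_nonneg y))]

theorem cosTransform_bump_le {y : ℝ} (hy : 2 ≤ |y|) : |cosTransform bump y| ≤ 1 / y ^ 2 := by
  refine le_trans ?_ (abs_cosTransform_bumpLap_le hy)
  have hy2 : 4 ≤ y ^ 2 := by rw [← sq_abs]; nlinarith
  rw [cosTransform_bumpLap, abs_mul, abs_of_nonpos (by linarith : 1 - y ^ 2 ≤ 0)]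
  nlinarith [abs_nonneg (cosTransform bump y)]

/-- Summability of samples of a function dominated by `1 / y²` for large `y`. -/
theorem summable_of_abs_le_inv_sq {f : ℝ → ℝ} (hf : ∀ y, 2 ≤ |y| → |f y| ≤ 1 / y ^ 2) {q : ℝ}
    (hq : 0 < q) : Summable fun k : ℤ => f (k * q) := by
  have hs : Summable fun k : ℤ => (1 / q ^ 2) * (1 / (k : ℝ) ^ 2) :=
    (Real.summable_one_div_int_pow.2 one_lt_two).mul_left _
  refine hs.of_norm_bounded_eventually ?_
  have hfin : {k : ℤ | |(k : ℝ)| ≤ 2 / q}.Finite := by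
    refine (Set.finite_Icc (-⌈2 / q⌉) ⌈2 / q⌉).subset fun k hk => ?_
    have hk := abs_le.1 (le_trans (show |(k : ℝ)| ≤ 2 / q from hk) (Int.le_ceil _))
    exact ⟨by exact_mod_cast hk.1, by exact_mod_cast hk.2⟩
  filter_upwards [hfin.compl_mem_cofinite] with k hk
  have hk : 2 / q < |(k : ℝ)| := not_le.1 hk
  rw [div_lt_iff₀ hq] at hk
  refine (hf _ ?_).trans (le_of_eq ?_)
  · rw [abs_mul, abs_of_pos hq]; exact hk.le
  · rw [mul_pow, one_div_mul_one_div, mul_comm]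

end Vandermonde

namespace Vandermonde

open Real ComplexConjugate UnitAddTorus

/-! ### Products of series -/

theorem hasSum_mul_of_complex {α β : Type*} {f : α → ℂ} {g : β → ℂ} {s t : ℂ} (hf : HasSum f s)
    (hg : HasSum g t) : HasSum (fun p : α × β => f p.1 * g p.2) (s * t) :=
  hf.mul hg (summable_mul_of_summable_norm hf.summable.norm hg.summable.norm)

theorem hasSum_pi_prod {d : ℕ} {f : Fin d → ℤ → ℂ} {S : Fin d → ℂ} (hf : ∀ i, HasSum (f i) (S i)) :
    HasSum (fun k : Fin d → ℤ => ∏ i, f i (k i)) (∏ i, S i) := by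
  induction d with
  | zero => simp
  | succ d ih =>
    have ih' : HasSum (fun k : Fin d → ℤ => ∏ i : Fin d, f i.succ (k i)) (∏ i : Fin d, S i.succ) :=
      ih fun i => hf i.succ
    have h := hasSum_mul_of_complex (hf 0) ih'
    rw [← (Fin.consEquiv fun _ : Fin (d + 1) => ℤ).hasSum_iff, Fin.prod_univ_succ]
    have e : (fun k : Fin (d + 1) → ℤ => ∏ i, f i (k i)) ∘ (Fin.consEquiv fun _ : Fin (d + 1) => ℤ) =
        fun p : ℤ × (Fin d → ℤ) => f 0 p.1 * ∏ i : Fin d, f i.succ (p.2 i) := by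
      ext p
      simp [Fin.consEquiv, Fin.prod_univ_succ]
    rw [e]
    exact h

/-! ### The smallest singular value -/

theorem le_sigmaMin {m n : Type*} [Fintype m] [Fintype n] [DecidableEq n] [Nonempty n]
    (A : Matrix m n ℂ) {b : ℝ}
    (h : ∀ c : n → ℂ, b ^ 2 * ∑ i, ‖c i‖ ^ 2 ≤ ∑ k, ‖(A.mulVec c) k‖ ^ 2) : b ≤ sigmaMin A := by
  set T := Matrix.toEuclideanLin A
  have hn : Fintype.card n - 1 < Module.finrank ℂ (EuclideanSpace ℂ n) := by
    rw [finrank_euclideanSpace]; exact Nat.sub_lt Fintype.card_pos one_pos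
  obtain ⟨v, hv⟩ := (T.hasEigenvalue_adjoint_comp_self_sq_singularValues hn).exists_hasEigenvector
  have h1 : ‖T v‖ ^ 2 = (T.singularValues (Fintype.card n - 1)) ^ 2 * ‖v‖ ^ 2 := by
    have e := congrArg (fun u => inner ℂ u v) hv.apply_eq_smul
    simp only [LinearMap.comp_apply, LinearMap.adjoint_inner_left, inner_smul_left,
      inner_self_eq_norm_sq_to_K] at e
    simp only [map_pow] at e
    have e2 := congrArg Complex.re e
    norm_cast at e2
    simp at e2
    norm_cast at e2
    linarith
  have h2 := h v.ofLp
  have h3 : ∑ k, ‖(A.mulVec v.ofLp) k‖ ^ 2 = ‖T v‖ ^ 2 := by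
    rw [EuclideanSpace.norm_sq_eq]; rfl
  rw [h3, ← EuclideanSpace.norm_sq_eq, h1] at h2
  have hv0 : 0 < ‖v‖ ^ 2 := by
    have := norm_pos_iff.2 hv.2
    positivity
  exact le_of_sq_le_sq (le_of_mul_le_mul_right h2 hv0) (T.singularValues_nonneg _)

/-- A diagonally dominant quadratic form is bounded below. -/
theorem le_re_sum_of_dominant {ι : Type*} [Fintype ι] [DecidableEq ι] (M : ι → ι → ℂ) {M0 l : ℝ}
    (hdiag : ∀ i, M i i = M0) (hsymm : ∀ i j, ‖M i j‖ = ‖M j i‖)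
    (hdom : ∀ i, ∑ j ∈ Finset.univ.erase i, ‖M i j‖ ≤ M0 - l) (c : ι → ℂ) :
    l * ∑ i, ‖c i‖ ^ 2 ≤ (∑ i, ∑ j, c i * conj (c j) * M i j).re := by
  have e : ∀ i, (∑ j, c i * conj (c j) * M i j).re =
      M0 * ‖c i‖ ^ 2 + ∑ j ∈ Finset.univ.erase i, (c i * conj (c j) * M i j).re := by
    intro i
    rw [Complex.re_sum, ← Finset.add_sum_erase _ _ (Finset.mem_univ i), hdiag, Complex.mul_conj,
      Complex.normSq_eq_norm_sq]
    congr 1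
    norm_cast
    ring
  -- AM-GM on each off-diagonal term; by the symmetry of ‖M i j‖ both halves then count towards row
  -- sums.
  have hterm : ∀ i j, -((‖c i‖ ^ 2 + ‖c j‖ ^ 2) / 2 * ‖M i j‖) ≤ (c i * conj (c j) * M i j).re := by
    intro i j
    have h1 := (abs_le.1 (Complex.abs_re_le_norm (c i * conj (c j) * M i j))).1
    rw [norm_mul, norm_mul, RCLike.norm_conj] at h1
    have h2 : ‖c i‖ * ‖c j‖ ≤ (‖c i‖ ^ 2 + ‖c j‖ ^ 2) / 2 := by nlinarith [sq_nonneg (‖c i‖ - ‖c j‖)]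
    linarith [mul_le_mul_of_nonneg_right h2 (norm_nonneg (M i j))]
  have hswap : ∑ i, ∑ j ∈ Finset.univ.erase i, ‖c j‖ ^ 2 * ‖M i j‖ =
      ∑ i, ∑ j ∈ Finset.univ.erase i, ‖c i‖ ^ 2 * ‖M i j‖ := by
    rw [Finset.sum_comm' (t' := Finset.univ) (s' := fun i => Finset.univ.erase i)]
    · simp_rw [hsymm]
    · simp [eq_comm]
  rw [Complex.re_sum]
  simp_rw [e]
  have hrow : ∀ i, ∑ j ∈ Finset.univ.erase i, ‖c i‖ ^ 2 * ‖M i j‖ ≤ ‖c i‖ ^ 2 * (M0 - l) := fun i => by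
    rw [← Finset.mul_sum]
    exact mul_le_mul_of_nonneg_left (hdom i) (sq_nonneg _)
  have h3 : ∑ i, ∑ j ∈ Finset.univ.erase i, -((‖c i‖ ^ 2 + ‖c j‖ ^ 2) / 2 * ‖M i j‖) =
      - ∑ i, ∑ j ∈ Finset.univ.erase i, ‖c i‖ ^ 2 * ‖M i j‖ := by
    have h4 : ∀ i j, -((‖c i‖ ^ 2 + ‖c j‖ ^ 2) / 2 * ‖M i j‖) =
      -(1 / 2) * (‖c i‖ ^ 2 * ‖M i j‖) + -(1 / 2) * (‖c j‖ ^ 2 * ‖M i j‖) := fun i j => by ring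
    have h7 : ∑ i, ∑ j ∈ Finset.univ.erase i, -((‖c i‖ ^ 2 + ‖c j‖ ^ 2) / 2 * ‖M i j‖) =
        -(1 / 2) * (∑ i, ∑ j ∈ Finset.univ.erase i, ‖c i‖ ^ 2 * ‖M i j‖) +
        -(1 / 2) * (∑ i, ∑ j ∈ Finset.univ.erase i, ‖c j‖ ^ 2 * ‖M i j‖) := by
      simp only [h4, Finset.mul_sum, Finset.sum_add_distrib]
    rw [h7, hswap]
    ring
  have h5 := Finset.sum_le_sum fun i (_ : i ∈ Finset.univ) => hrow i
  have h6 := Finset.sum_le_sum fun i (_ : i ∈ Finset.univ) =>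
    Finset.sum_le_sum fun j (_ : j ∈ Finset.univ.erase i) => hterm i j
  rw [Finset.sum_add_distrib, ← Finset.mul_sum]
  rw [← Finset.sum_mul] at h5
  linarith

/-! ### Lower bounds by minorants -/

theorem mFourier_sub_apply {d : ℕ} (k : Fin d → ℤ) (x y : UnitAddTorus (Fin d)) :
    mFourier k (x - y) = conj (mFourier (-k) x) * mFourier (-k) y := by
  rw [mFourier_neg, mFourier_neg, Complex.conj_conj]
  simp only [mFourier, ContinuousMap.coe_mk, map_prod, ← Finset.prod_mul_distrib, Pi.sub_apply]
  refine Finset.prod_congr rfl fun i _ => ?_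
  rw [sub_eq_add_neg, ← fourier_neg]
  simp [fourier_apply, smul_add, AddCircle.toCircle_add]

theorem mFourier_neg_apply {d : ℕ} (k : Fin d → ℤ) (x : UnitAddTorus (Fin d)) :
    mFourier k (-x) = conj (mFourier k x) := by
  simp only [mFourier, ContinuousMap.coe_mk, map_prod, Pi.neg_apply]
  refine Finset.prod_congr rfl fun i _ => ?_
  rw [← fourier_neg]
  simp [fourier_apply]

theorem norm_trigSum_sq {d : ℕ} {Y : Finset (UnitAddTorus (Fin d))} (c : Y → ℂ) (k : Fin d → ℤ) :
    ((‖∑ t : Y, mFourier (-k) (t : UnitAddTorus (Fin d)) * c t‖ ^ 2 : ℝ) : ℂ) =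
      ∑ t : Y, ∑ t' : Y, c t * conj (c t') * mFourier k (t' - t : UnitAddTorus (Fin d)) := by
  rw [← Complex.normSq_eq_norm_sq, ← Complex.mul_conj, map_sum, Finset.sum_mul_sum]
  refine Finset.sum_congr rfl fun t _ => Finset.sum_congr rfl fun t' _ => ?_
  rw [mFourier_sub_apply, map_mul]
  ring

/-- Weighting |Σ_t c_t e^{-2πi t·k}|² by w(k) and summing over all k gives at most ‖𝒜c‖². Expanding
the squares produces the form with entries W(t' - t), Hermitian because w is real. -/
theorem le_sigmaMin_vandermondeMatrix {d N : ℕ} {Y : Finset (UnitAddTorus (Fin d))}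
    (hY : Y.Nonempty) {w : (Fin d → ℤ) → ℝ} {W : UnitAddTorus (Fin d) → ℂ}
    (hW : ∀ x, HasSum (fun k => (w k : ℂ) * mFourier k x) (W x))
    (hw1 : ∀ k ∈ freqBall d N, w k ≤ 1) (hw0 : ∀ k ∉ freqBall d N, w k ≤ 0) {W0 b : ℝ}
    (h0 : W 0 = W0)
    (hdom : ∀ t ∈ Y, ∑ t' ∈ Y.erase t, ‖W (t' - t)‖ ≤ W0 - b ^ 2) :
    b ≤ sigmaMin (vandermondeMatrix N Y) := by
  classical
  have : Nonempty Y := hY.to_subtype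
  refine le_sigmaMin _ fun c => ?_
  have hsymm : ∀ x, W (-x) = conj (W x) := fun x => by
    have h := Complex.hasSum_conj'.2 (hW x)
    simp only [map_mul, Complex.conj_ofReal, ← mFourier_neg_apply] at h
    exact (hW (-x)).unique (by simpa using h)
  have hquad := le_re_sum_of_dominant (fun t t' : Y => W (t' - t : UnitAddTorus (Fin d)))
    (M0 := W0) (l := b ^ 2) (fun i => by simp [h0])
    (fun i j => by rw [← neg_sub, hsymm, RCLike.norm_conj])
    (fun i => by
      refine le_trans (le_of_eq ?_) (hdom i i.2)
      refine Finset.sum_bij (fun a _ => (a : UnitAddTorus (Fin d))) ?_ ?_ ?_ ?_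
      · intro a ha
        exact Finset.mem_erase.2 ⟨fun h => Finset.ne_of_mem_erase ha (Subtype.ext h), a.2⟩
      · intro a _ a' _ h; exact Subtype.ext h
      · intro x hx
        exact ⟨⟨x, (Finset.mem_erase.1 hx).2⟩, Finset.mem_erase.2
          ⟨fun h => (Finset.mem_erase.1 hx).1 (congrArg Subtype.val h), Finset.mem_univ _⟩, rfl⟩
      · intro a _; rfl) c
  refine hquad.trans ?_
  have hs : HasSum (fun k => (w k : ℂ) *
      ((‖∑ t : Y, mFourier (-k) (t : UnitAddTorus (Fin d)) * c t‖ ^ 2 : ℝ) : ℂ))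
      (∑ t : Y, ∑ t' : Y, c t * conj (c t') * W (t' - t : UnitAddTorus (Fin d))) := by
    have := hasSum_sum fun (t : Y) (_ : t ∈ Finset.univ) =>
      hasSum_sum fun (t' : Y) (_ : t' ∈ Finset.univ) =>
        (hW (t' - t : UnitAddTorus (Fin d))).mul_left (c t * conj (c t') : ℂ)
    convert! this using 2 with k
    rw [norm_trigSum_sq, Finset.mul_sum]
    refine Finset.sum_congr rfl fun t _ => ?_
    rw [Finset.mul_sum]
    exact Finset.sum_congr rfl fun t' _ => by ring
  have hsr := Complex.hasSum_re hs
  simp only [← Complex.ofReal_mul, Complex.ofReal_re] at hsr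
  have hball : ∑ k : freqBall d N, ‖((vandermondeMatrix N Y).mulVec c) k‖ ^ 2 =
      ∑ k ∈ freqBall d N, ‖∑ t : Y, mFourier (-k) (t : UnitAddTorus (Fin d)) * c t‖ ^ 2 := by
    exact Finset.sum_coe_sort (freqBall d N)
      fun k => ‖∑ t : Y, mFourier (-k) (t : UnitAddTorus (Fin d)) * c t‖ ^ 2
  rw [hball]
  have hfin : HasSum (fun k => if k ∈ freqBall d N then
      ‖∑ t : Y, mFourier (-k) (t : UnitAddTorus (Fin d)) * c t‖ ^ 2 else 0)
      (∑ k ∈ freqBall d N, ‖∑ t : Y, mFourier (-k) (t : UnitAddTorus (Fin d)) * c t‖ ^ 2) := by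
    have := hasSum_sum_of_ne_finset_zero (L := .unconditional _) (s := freqBall d N)
      (f := fun k => if k ∈ freqBall d N then ‖∑ t : Y, mFourier (-k) (t : UnitAddTorus (Fin d)) * c t‖ ^ 2 else 0) fun k hk => if_neg hk
    rwa [Finset.sum_congr rfl fun k hk => if_pos hk] at this
  refine hasSum_le (fun k => ?_) hsr hfin
  split_ifs with hk
  · exact mul_le_of_le_one_left (sq_nonneg _) (hw1 k hk)
  · exact mul_nonpos_of_nonpos_of_nonneg (hw0 k hk) (sq_nonneg _)

/-- The nodes contributing to the row of t share its cluster, so there is at most one of them. -/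
theorem sum_norm_le_of_isPairClustering {d : ℕ} {q : ℝ} {Y : Finset (UnitAddTorus (Fin d))}
    {C : Set (Set (UnitAddTorus (Fin d)))} (hC : IsPairClustering q (Y : Set (UnitAddTorus (Fin d))) C)
    {W : UnitAddTorus (Fin d) → ℂ} {B : ℝ} (hB : 0 ≤ B)
    (hW : ∀ t ∈ Y, ∀ t' ∈ Y, t' ≠ t → ‖W (t' - t)‖ ≤ B)
    (h0 : ∀ Λ₁ ∈ C, ∀ Λ₂ ∈ C, Λ₁ ≠ Λ₂ → ∀ t ∈ Λ₁, ∀ t' ∈ Λ₂, W (t' - t) = 0)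
    {t : UnitAddTorus (Fin d)} (ht : t ∈ Y) :
    ∑ t' ∈ Y.erase t, ‖W (t' - t)‖ ≤ B := by
  have hmem : ∀ x ∈ Y, ∃ Λ ∈ C, x ∈ Λ := fun x hx => by
    have : x ∈ ⋃₀ C := hC.sUnion_eq ▸ (Finset.mem_coe.2 hx)
    simpa using this
  obtain ⟨Λ, hΛ, htΛ⟩ := hmem t ht
  rw [← Finset.sum_filter_ne_zero]
  set F := (Y.erase t).filter fun t' => ‖W (t' - t)‖ ≠ 0 with hF
  have hsub : ((insert t F : Finset _) : Set (UnitAddTorus (Fin d))) ⊆ Λ := by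
    intro x hx
    rcases Finset.mem_insert.1 (Finset.mem_coe.1 hx) with rfl | hx
    · exact htΛ
    · obtain ⟨hx1, hx2⟩ := Finset.mem_filter.1 hx
      obtain ⟨Λ', hΛ', hxΛ'⟩ := hmem x (Finset.mem_of_mem_erase hx1)
      by_contra hne
      refine hx2 ?_
      rw [h0 Λ hΛ Λ' hΛ' (fun h => hne (h ▸ hxΛ')) t htΛ x hxΛ', norm_zero]
  have hcard : F.card ≤ 1 := by
    have h1 := (Set.encard_le_encard hsub).trans (hC.card_le_two Λ hΛ)
    rw [Set.encard_coe_eq_coe_finsetCard, Finset.card_insert_of_notMem (by simp [hF])] at h1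
    have : F.card + 1 ≤ 2 := by exact_mod_cast h1
    omega
  have h2 := Finset.sum_le_card_nsmul F (fun t' => ‖W (t' - t)‖) B fun x hx => by
    have hx1 := (Finset.mem_filter.1 hx).1
    exact hW t ht x (Finset.mem_of_mem_erase hx1) (Finset.ne_of_mem_erase hx1)
  refine h2.trans ?_
  rw [nsmul_eq_mul]
  have : (F.card : ℝ) ≤ 1 := by exact_mod_cast hcard
  nlinarith

/-! ### Periodization -/

/-- The periodization of the even extension of `h`, restricted to `[0, 1]` and scaled by `q`. -/
noncomputable def periodization (h : ℝ → ℝ) (hc : Continuous h) (q : ℝ) : C(UnitAddCircle, ℂ) :=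
  ⟨fun x => ((h (min (‖x‖ / q) 1) : ℝ) : ℂ), by fun_prop⟩

-- The support [-q, q] fits into one period since q ≤ 1/2, and `h 1 = 0` removes the clamped part;
-- the rest is the substitution x = qs.
open intervalIntegral in
theorem fourierCoeff_periodization {h : ℝ → ℝ} (hc : Continuous h) (h1 : h 1 = 0) {q : ℝ}
    (hq : 0 < q) (hq2 : q ≤ 1 / 2) (k : ℤ) :
    fourierCoeff (periodization h hc q) k = ((q * cosTransform h (k * q) : ℝ) : ℂ) := by
  rw [fourierCoeff_eq_intervalIntegral _ k (-(1 / 2))]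
  set g : ℝ → ℂ := fun x => fourier (-k) (x : UnitAddCircle) • ((h (min (|x| / q) 1) : ℝ) : ℂ)
  have hg : Continuous g := by
    have : Continuous fun x : ℝ => fourier (-k) (x : UnitAddCircle) :=
      (fourier (-k)).continuous.comp (AddCircle.continuous_mk' 1)
    fun_prop
  have e1 : ∫ x in -(1 / 2)..-(1 / 2) + (1 : ℝ), fourier (-k) (x : UnitAddCircle) •
      periodization h hc q x = ∫ x in -(1 / 2 : ℝ)..1 / 2, g x := by
    have : -(1 / 2) + (1 : ℝ) = 1 / 2 := by norm_num
    rw [this]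
    refine integral_congr fun x hx => ?_
    rw [Set.uIcc_of_le (by norm_num)] at hx
    have hx' : ‖(x : UnitAddCircle)‖ = |x| := by
      rw [AddCircle.norm_coe_eq_abs_iff (p := 1) one_ne_zero, abs_one]
      exact abs_le.2 hx
    simp [g, periodization, hx']
  have hi : ∀ a b : ℝ, IntervalIntegrable g MeasureTheory.volume a b := fun a b => hg.intervalIntegrable a b
  have e2 : ∫ x in -(1 / 2 : ℝ)..1 / 2, g x = ∫ x in (0 : ℝ)..1 / 2, (g x + g (-x)) := by
    have hn : IntervalIntegrable (fun x => g (-x)) MeasureTheory.volume 0 (1 / 2) :=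
      (hg.comp continuous_neg).intervalIntegrable _ _
    rw [← integral_add_adjacent_intervals (hi _ 0) (hi 0 _), intervalIntegral.integral_add (hi _ _) hn,
      integral_comp_neg, neg_zero, add_comm]
  have e3 : ∀ x : ℝ, g x + g (-x) = ((2 * (h (min (|x| / q) 1) * cos (2 * π * k * x)) : ℝ) : ℂ) := by
    intro x
    simp only [g, abs_neg, fourier_coe_apply, smul_eq_mul]
    push_cast
    rw [Complex.cos]
    have a1 : 2 * ↑π * Complex.I * -(k : ℂ) * (x : ℂ) / 1 = -(2 * π * k * x) * Complex.I := by ring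
    have a2 : 2 * ↑π * Complex.I * -(k : ℂ) * -(x : ℂ) / 1 = (2 * π * k * x) * Complex.I := by ring
    rw [a1, a2]
    ring
  rw [e1, e2]
  simp_rw [e3]
  rw [intervalIntegral.integral_ofReal, one_div_one, one_smul, Complex.ofReal_inj,
    intervalIntegral.integral_const_mul]
  have hi2 : ∀ a b : ℝ, IntervalIntegrable (fun x => h (min (|x| / q) 1) * cos (2 * π * k * x))
      MeasureTheory.volume a b := fun a b => by apply Continuous.intervalIntegrable; fun_prop
  have e4 : ∫ x in q..1 / 2, h (min (|x| / q) 1) * cos (2 * π * k * x) = 0 := by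
    rw [← integral_zero (a := q) (b := 1 / 2) (μ := MeasureTheory.volume) (E := ℝ)]
    refine integral_congr fun x hx => ?_
    rw [Set.uIcc_of_le hq2] at hx
    have hx1 : 1 ≤ |x| / q := by rw [le_div_iff₀ hq, one_mul]; exact hx.1.trans (le_abs_self x)
    simp [min_eq_right hx1, h1]
  have e5 : ∫ x in (0 : ℝ)..q, h (min (|x| / q) 1) * cos (2 * π * k * x) =
      q * ∫ s in (0 : ℝ)..1, h s * cos (2 * π * (k * q) * s) := by
    have := integral_comp_div (a := 0) (b := q) (fun s => h s * cos (2 * π * (k * q) * s)) hq.ne'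
    rw [zero_div, div_self hq.ne', smul_eq_mul] at this
    rw [← this]
    refine integral_congr fun x hx => ?_
    rw [Set.uIcc_of_le hq.le] at hx
    have hx2 : min (|x| / q) 1 = x / q := by
      rw [abs_of_nonneg hx.1, min_eq_left]
      rw [div_le_iff₀ hq, one_mul]
      exact hx.2
    simp only [hx2]
    congr 2
    field_simp
  rw [← integral_add_adjacent_intervals (hi2 0 q) (hi2 q _), e4, e5, cosTransform]
  ring

theorem hasSum_periodization {h : ℝ → ℝ} (hc : Continuous h) (h1 : h 1 = 0) {q : ℝ}
    (hq : 0 < q) (hq2 : q ≤ 1 / 2) (hdecay : ∀ y, 2 ≤ |y| → |cosTransform h y| ≤ 1 / y ^ 2)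
    (x : UnitAddCircle) :
    HasSum (fun k : ℤ => ((cosTransform h (k * q) : ℝ) : ℂ) * fourier k x)
      ((h (min (‖x‖ / q) 1) / q : ℝ) : ℂ) := by
  have hs : Summable (fourierCoeff (periodization h hc q)) := by
    simp_rw [funext (fourierCoeff_periodization hc h1 hq hq2)]
    exact_mod_cast (summable_of_abs_le_inv_sq hdecay hq).mul_left q
  have := (has_pointwise_sum_fourier_series_of_summable hs x).mul_left ((q : ℂ)⁻¹)
  have hq' : (q : ℂ) ≠ 0 := by exact_mod_cast hq.ne'
  convert! this using 1
  · ext k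
    rw [fourierCoeff_periodization hc h1 hq hq2, smul_eq_mul]
    push_cast
    field_simp
  · simp only [periodization, ContinuousMap.coe_mk]
    push_cast
    field_simp

end Vandermonde

/-! ### The localizing kernel and the case q ≤ 1/2. -/

namespace Vandermonde

open Real UnitAddTorus

theorem exists_norm_apply_eq {d : ℕ} (hd : 0 < d) (x : UnitAddTorus (Fin d)) :
    ∃ i, ‖x i‖ = ‖x‖ := by
  have : Nonempty (Fin d) := ⟨⟨0, hd⟩⟩
  obtain ⟨i, hi⟩ := Finite.exists_max fun i => ‖x i‖
  exact ⟨i, le_antisymm (norm_le_pi_norm x i) ((pi_norm_le_iff_of_nonneg (norm_nonneg _)).2 hi)⟩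

theorem mem_freqBall {d N : ℕ} {k : Fin d → ℤ} :
    k ∈ freqBall d N ↔ ∑ i, (k i : ℝ) ^ 2 ≤ (N : ℝ) ^ 2 := by
  rw [freqBall, Set.Finite.mem_toFinset, freqBallSet, Set.mem_ofPred_eq,
    ← sq_le_sq₀ (norm_nonneg _) (Nat.cast_nonneg _), EuclideanSpace.norm_sq_eq]
  simp

/-- The factors of the localizing kernel: in direction `i` the function `bumpLap`, in all other
directions the normalised `bump`, scaled by `q`. -/
noncomputable def kernelFactor {d : ℕ} (q : ℝ) (x : UnitAddTorus (Fin d)) (i j : Fin d) : ℝ :=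
  if j = i then bumpLap (min (‖x j‖ / q) 1) else 2 / 3 * bump (min (‖x j‖ / q) 1)

/-- The localizing kernel, supported in the cube of radius `q`. -/
noncomputable def kernel {d : ℕ} (q : ℝ) (x : UnitAddTorus (Fin d)) : ℝ :=
  (3 / 2 / q) ^ d * (2 / 3) / d * ∑ i, ∏ j, kernelFactor q x i j

section kernel

variable {d : ℕ} {q : ℝ}

theorem kernelFactor_mem (hq : 0 < q) (x : UnitAddTorus (Fin d)) (i j : Fin d) :
    0 ≤ kernelFactor q x i j ∧ kernelFactor q x i j ≤ 1 := by
  have h0 : 0 ≤ min (‖x j‖ / q) 1 := le_min (by positivity) zero_le_one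
  have h1 : min (‖x j‖ / q) 1 ≤ 1 := min_le_right _ _
  unfold kernelFactor
  split_ifs
  · exact ⟨bumpLap_nonneg h1, bumpLap_le_one h0⟩
  · have := bump_nonneg h0 h1
    have := bump_le_three_halves h0 h1
    constructor <;> linarith

theorem kernel_nonneg (hq : 0 < q) (x : UnitAddTorus (Fin d)) : 0 ≤ kernel q x :=
  mul_nonneg (by positivity) (Finset.sum_nonneg fun i _ => Finset.prod_nonneg fun j _ =>
    (kernelFactor_mem hq x i j).1)

theorem kernel_zero (hd : 0 < d) : kernel q (0 : UnitAddTorus (Fin d)) =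
    (3 / 2 / q) ^ d * (2 / 3) := by
  have h : ∀ i j : Fin d, kernelFactor q (0 : UnitAddTorus (Fin d)) i j = 1 := fun i j => by
    simp [kernelFactor, bumpLap_zero, bump_zero]
  have : (d : ℝ) ≠ 0 := by positivity
  simp only [kernel, h, Finset.prod_const_one, Finset.sum_const, Finset.card_univ,
    Fintype.card_fin, nsmul_eq_mul, mul_one]
  field_simp

theorem kernel_eq_zero (hd : 0 < d) (hq : 0 < q) {x : UnitAddTorus (Fin d)} (hx : q ≤ ‖x‖) :
    kernel q x = 0 := by
  obtain ⟨j, hj⟩ := exists_norm_apply_eq hd x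
  have h1 : min (‖x j‖ / q) 1 = 1 := min_eq_right (by rwa [hj, le_div_iff₀ hq, one_mul])
  have h : ∀ i, ∏ j, kernelFactor q x i j = 0 := fun i =>
    Finset.prod_eq_zero (Finset.mem_univ j) (by simp [kernelFactor, h1, bump_one, bumpLap_one])
  simp [kernel, h]

/-- Keep only the factor in a direction j of maximal coordinate, bounding the others by 1. Over i
this leaves one `bumpLap` and d - 1 copies of `bump`. The former with one of the latter drops by
(3/2)s², each of the remaining d - 2 by s²; hence the constant d - 1/2. -/
theorem kernel_le (hd : 2 ≤ d) (hq : 0 < q) (x : UnitAddTorus (Fin d)) :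
    kernel q x ≤ (3 / 2 / q) ^ d * (2 / 3) -
      (3 / 2 / q) ^ d * (2 / 3) * ((d - 1 / 2) / d) * (min (‖x‖ / q) 1) ^ 2 := by
  obtain ⟨j, hj⟩ := exists_norm_apply_eq (by omega) x
  set s := min (‖x‖ / q) 1 with hs
  have h0 : 0 ≤ s := le_min (by positivity) zero_le_one
  have h1 : s ≤ 1 := min_le_right _ _
  have hd' : (2 : ℝ) ≤ d := by exact_mod_cast hd
  have hprod : ∀ i, ∏ j, kernelFactor q x i j ≤
      2 / 3 * bump s + if i = j then bumpLap s - 2 / 3 * bump s else 0 := by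
    intro i
    rw [← Finset.mul_prod_erase _ _ (Finset.mem_univ j)]
    refine (mul_le_of_le_one_right (kernelFactor_mem hq x i j).1
      (Finset.prod_le_one (fun l _ => (kernelFactor_mem hq x i l).1)
        fun l _ => (kernelFactor_mem hq x i l).2)).trans (le_of_eq ?_)
    simp only [kernelFactor, hj, ← hs, eq_comm (a := j)]
    split_ifs <;> ring
  have hsum : ∑ i, ∏ j, kernelFactor q x i j ≤ d - (d - 1 / 2) * s ^ 2 := by
    refine (Finset.sum_le_sum fun i _ => hprod i).trans ?_
    rw [Finset.sum_add_distrib, Finset.sum_ite_eq' Finset.univ j]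
    simp only [Finset.sum_const, Finset.card_univ, Fintype.card_fin, nsmul_eq_mul,
      Finset.mem_univ, if_true]
    have i1 := bump_add_bumpLap_le h0 h1
    have i2 := bump_le h0 h1
    nlinarith
  have hK : 0 ≤ (3 / 2 / q) ^ d * (2 / 3) / d := by positivity
  refine (mul_le_mul_of_nonneg_left hsum hK).trans (le_of_eq ?_)
  field_simp

/-- The Fourier coefficients of the kernel. -/
theorem hasSum_kernel (hd : 0 < d) (hq : 0 < q) (hq2 : q ≤ 1 / 2) (x : UnitAddTorus (Fin d)) :
    HasSum (fun k : Fin d → ℤ =>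
      (((∏ j, cosTransform bump (k j * q)) * (1 - (q ^ 2 / d) * ∑ i, (k i : ℝ) ^ 2) : ℝ) : ℂ) *
        mFourier k x) (kernel q x : ℂ) := by
  have hd' : (d : ℂ) ≠ 0 := by exact_mod_cast hd.ne'
  have h1 : ∀ i : Fin d, HasSum (fun k : Fin d → ℤ => ∏ j,
      (if j = i then ((cosTransform bumpLap (k j * q) : ℝ) : ℂ) * fourier (k j) (x j)
        else ((cosTransform bump (k j * q) : ℝ) : ℂ) * fourier (k j) (x j)))
      (∏ j, if j = i then ((bumpLap (min (‖x j‖ / q) 1) / q : ℝ) : ℂ)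
        else ((bump (min (‖x j‖ / q) 1) / q : ℝ) : ℂ)) := by
    intro i
    refine hasSum_pi_prod (f := fun j n => if j = i then
      ((cosTransform bumpLap (n * q) : ℝ) : ℂ) * fourier n (x j)
        else ((cosTransform bump (n * q) : ℝ) : ℂ) * fourier n (x j)) fun j => ?_
    split_ifs
    · exact hasSum_periodization continuous_bumpLap bumpLap_one hq hq2
        (fun y => abs_cosTransform_bumpLap_le) _
    · exact hasSum_periodization continuous_bump bump_one hq hq2
        (fun y => cosTransform_bump_le) _
  have h2 := (hasSum_sum fun i (_ : i ∈ Finset.univ) => h1 i).mul_left ((d : ℂ)⁻¹)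
  convert! h2 using 1
  · ext k
    -- The special direction only adds the factor 1 - (q k_i)², by `cosTransform_bumpLap`; averaging
    -- over i gives the radial factor.
    have e : ∀ i : Fin d, ∏ j,
        (if j = i then ((cosTransform bumpLap (k j * q) : ℝ) : ℂ) * fourier (k j) (x j)
        else ((cosTransform bump (k j * q) : ℝ) : ℂ) * fourier (k j) (x j)) =
        (∏ j, ((cosTransform bump (k j * q) : ℝ) : ℂ)) * mFourier k x * (1 - (k i * q) ^ 2) := by
      intro i
      have e1 : ∀ j : Fin d,
        (if j = i then ((cosTransform bumpLap (k j * q) : ℝ) : ℂ) * fourier (k j) (x j)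
        else ((cosTransform bump (k j * q) : ℝ) : ℂ) * fourier (k j) (x j)) =
        ((cosTransform bump (k j * q) : ℝ) : ℂ) * fourier (k j) (x j) *
          (if j = i then (1 - (k j * q) ^ 2 : ℂ) else 1) := by
        intro j
        split_ifs
        · rw [cosTransform_bumpLap]; push_cast; ring
        · ring
      simp_rw [e1]
      rw [Finset.prod_mul_distrib, Finset.prod_mul_distrib, Finset.prod_ite_eq' Finset.univ i]
      simp [mFourier]
    simp_rw [e]
    rw [← Finset.mul_sum, Finset.sum_sub_distrib]
    simp only [mul_pow, ← Finset.sum_mul, Finset.sum_const, Finset.card_univ, Fintype.card_fin,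
      nsmul_eq_mul, mul_one]
    push_cast
    generalize ∏ j, ((cosTransform bump (k j * q) : ℝ) : ℂ) = A
    field_simp
  · have e : ∀ i : Fin d, (∏ j, if j = i then ((bumpLap (min (‖x j‖ / q) 1) / q : ℝ) : ℂ)
        else ((bump (min (‖x j‖ / q) 1) / q : ℝ) : ℂ)) =
        (((3 / 2 / q) ^ d * (2 / 3) * ∏ j, kernelFactor q x i j : ℝ) : ℂ) := by
      intro i
      have e1 : ∀ j : Fin d, (if j = i then ((bumpLap (min (‖x j‖ / q) 1) / q : ℝ) : ℂ)
        else ((bump (min (‖x j‖ / q) 1) / q : ℝ) : ℂ)) =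
        (((3 / 2 / q) * (if j = i then 2 / 3 else 1) * kernelFactor q x i j : ℝ) : ℂ) := by
        intro j
        unfold kernelFactor
        split_ifs
        · congr 1; field_simp
        · congr 1; field_simp
      simp_rw [e1]
      rw [← Complex.ofReal_prod, Finset.prod_mul_distrib, Finset.prod_mul_distrib,
        Finset.prod_ite_eq' Finset.univ i]
      simp only [Finset.prod_const, Finset.card_univ, Fintype.card_fin, Finset.mem_univ, if_true]
    simp_rw [e]
    rw [← Complex.ofReal_sum, ← Finset.mul_sum, kernel]
    push_cast
    field_simp

end kernel

theorem le_dist_of_le_clusterSep {d : ℕ} {C : Set (Set (UnitAddTorus (Fin d)))} {a : ℝ}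
    (h : ENNReal.ofReal a ≤ clusterSep C) {Λ₁ Λ₂ : Set (UnitAddTorus (Fin d))} (h1 : Λ₁ ∈ C)
    (h2 : Λ₂ ∈ C) (hne : Λ₁ ≠ Λ₂) {t t' : UnitAddTorus (Fin d)} (ht : t ∈ Λ₁) (ht' : t' ∈ Λ₂) :
    a ≤ ‖t' - t‖ := by
  have h3 : ENNReal.ofReal a ≤ edist t t' := by
    simp only [clusterSep, clusterDist, le_iInf_iff] at h
    exact h Λ₁ h1 Λ₂ h2 hne t ht t' ht'
  rw [edist_dist, ENNReal.ofReal_le_ofReal_iff dist_nonneg, dist_comm, dist_eq_norm] at h3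
  exact h3

theorem le_norm_of_le_einfsep {d : ℕ} {Y : Finset (UnitAddTorus (Fin d))} {τ : ℝ}
    (h : ENNReal.ofReal τ ≤ (Y : Set (UnitAddTorus (Fin d))).einfsep)
    {t t' : UnitAddTorus (Fin d)} (ht : t ∈ Y) (ht' : t' ∈ Y) (hne : t' ≠ t) : τ ≤ ‖t' - t‖ := by
  have h3 := Set.le_einfsep_iff.1 h t' ht' t ht hne
  rwa [edist_dist, ENNReal.ofReal_le_ofReal_iff dist_nonneg, dist_eq_norm] at h3

/-- The condition q²N² = d places the sign change of the kernel's coefficients on the sphere ‖k‖₂ =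
N. Cluster separation q suffices, as the kernel already vanishes at that distance. -/
theorem le_sigmaMin_of_le_half {d N : ℕ} (hd : 2 ≤ d) (hN : 1 ≤ N)
    {Y : Finset (UnitAddTorus (Fin d))} (hY : Y.Nonempty)
    {C : Set (Set (UnitAddTorus (Fin d)))} {q' q : ℝ}
    (hC : IsPairClustering q' (Y : Set (UnitAddTorus (Fin d))) C) {τ : ℝ} (hτ : 0 ≤ τ)
    (hq : 0 < q) (hqN : q ^ 2 * N ^ 2 = d) (hq2 : q ≤ 1 / 2) (hτq : τ ≤ q)
    (hsep : ENNReal.ofReal τ ≤ (Y : Set (UnitAddTorus (Fin d))).einfsep)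
    (hΔ : ENNReal.ofReal q ≤ clusterSep C) {b : ℝ}
    (hb : b ^ 2 ≤ (3 / 2 / q) ^ d * (2 / 3) * ((d - 1 / 2) / d) * (τ / q) ^ 2) :
    b ≤ sigmaMin (vandermondeMatrix N Y) := by
  have hd0 : 0 < d := by omega
  have hd' : (2 : ℝ) ≤ d := by exact_mod_cast hd
  have hN' : (0 : ℝ) < N := by exact_mod_cast hN
  have hK : 0 ≤ (3 / 2 / q) ^ d * (2 / 3) * ((d - 1 / 2) / d) := by
    have : (0 : ℝ) ≤ (d - 1 / 2) / d := div_nonneg (by linarith) (by linarith)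
    positivity
  have hprod : ∀ k : Fin d → ℤ, 0 ≤ ∏ j, cosTransform bump (k j * q) := fun k =>
    Finset.prod_nonneg fun j _ => cosTransform_bump_nonneg _
  have hqd : q ^ 2 / d = 1 / N ^ 2 := by
    rw [← hqN]; field_simp
  refine le_sigmaMin_vandermondeMatrix hY (hasSum_kernel hd0 hq hq2) (fun k hk => ?_)
    (fun k hk => ?_) (by rw [kernel_zero hd0]) fun t ht => ?_
  · refine mul_le_one₀ (Finset.prod_le_one (fun j _ => cosTransform_bump_nonneg _)
      fun j _ => (abs_le.1 (abs_cosTransform_bump_le _)).2) ?_ ?_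
    · rw [mem_freqBall] at hk
      rw [hqd, one_div_mul_eq_div, sub_nonneg, div_le_one (by positivity)]
      exact hk
    · have : 0 ≤ q ^ 2 / d * ∑ i, (k i : ℝ) ^ 2 := by positivity
      linarith
  · refine mul_nonpos_of_nonneg_of_nonpos (hprod k) ?_
    rw [mem_freqBall, not_le] at hk
    rw [hqd, one_div_mul_eq_div, sub_nonpos, one_le_div (by positivity)]
    exact hk.le
  · have hτq1 : τ / q ≤ 1 := by rwa [div_le_one hq]
    have hle : (3 / 2 / q) ^ d * (2 / 3) * ((d - 1 / 2) / d) * (τ / q) ^ 2 ≤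
        (3 / 2 / q) ^ d * (2 / 3) := by
      have h1 : (d - 1 / 2 : ℝ) / d ≤ 1 := by rw [div_le_one (by linarith)]; linarith
      have h2 : (τ / q) ^ 2 ≤ 1 := pow_le_one₀ (by positivity) hτq1
      have h3 : 0 ≤ (3 / 2 / q) ^ d * (2 / 3) := by positivity
      calc _ ≤ (3 / 2 / q) ^ d * (2 / 3) * ((d - 1 / 2) / d) := mul_le_of_le_one_right hK h2
        _ ≤ _ := mul_le_of_le_one_right h3 h1
    refine sum_norm_le_of_isPairClustering hC (W := fun x => (kernel q x : ℂ)) (by linarith)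
      (fun t ht t' ht' hne => ?_) (fun Λ₁ h1 Λ₂ h2 hne t ht t' ht' => ?_) ht
    · rw [Complex.norm_real, norm_eq_abs, abs_of_nonneg (kernel_nonneg hq _)]
      refine (kernel_le hd hq _).trans (sub_le_sub_left (hb.trans ?_) _)
      have h1 : τ / q ≤ min (‖t' - t‖ / q) 1 :=
        le_min (div_le_div_of_nonneg_right (le_norm_of_le_einfsep hsep ht ht' hne) hq.le) hτq1
      exact mul_le_mul_of_nonneg_left (pow_le_pow_left₀ (by positivity) h1 2) hK
    · simp only [Complex.ofReal_eq_zero]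
      exact kernel_eq_zero hd0 hq (le_dist_of_le_clusterSep hΔ h1 h2 hne ht ht')

end Vandermonde

/-! ### The Dirichlet kernel of the ball and the case q > 1/2. -/

namespace Vandermonde

open Real UnitAddTorus

/-- Concavity of sine between 0 and π/4 gives sin(πv/2) ≥ √2 v; then use cos(πv) = 1 - 2 sin²(πv/2).
-/
theorem cos_pi_mul_le {v : ℝ} (h0 : 0 ≤ v) (h1 : v ≤ 1 / 2) : cos (π * v) ≤ 1 - 4 * v ^ 2 := by
  have hc := strictConcaveOn_sin_Icc.concaveOn.2
    (show (0 : ℝ) ∈ Set.Icc 0 π from ⟨le_rfl, pi_pos.le⟩)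
    (show π / 4 ∈ Set.Icc 0 π from ⟨by positivity, by linarith [pi_pos]⟩)
    (show 0 ≤ 1 - 2 * v by linarith) (show 0 ≤ 2 * v by linarith) (by ring)
  simp only [smul_eq_mul, mul_zero, sin_zero, zero_add, sin_pi_div_four] at hc
  have e : cos (π * v) = 1 - 2 * sin (2 * v * (π / 4)) ^ 2 := by
    have h := cos_two_mul (2 * v * (π / 4))
    rw [cos_sq'] at h
    rw [show π * v = 2 * (2 * v * (π / 4)) by ring, h]
    ring
  have h2 : (2 * v * (√2 / 2)) ^ 2 ≤ sin (2 * v * (π / 4)) ^ 2 := pow_le_pow_left₀ (by positivity) hc 2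
  have h3 : (2 * v * (√2 / 2)) ^ 2 = 2 * v ^ 2 := by
    rw [mul_pow, div_pow, sq_sqrt zero_le_two]; ring
  rw [e]
  linarith

theorem norm_one_add_fourier_le (y : UnitAddCircle) :
    ‖1 + fourier 1 y‖ ≤ 2 * (1 - 4 * ‖y‖ ^ 2) := by
  obtain ⟨v, hv, rfl⟩ : ∃ v : ℝ, |v| ≤ 1 / 2 ∧ (v : UnitAddCircle) = y := by
    induction y using QuotientAddGroup.induction_on with
    | H r =>
      refine ⟨r - round r, abs_sub_round r, ?_⟩
      rw [AddCircle.coe_sub, sub_eq_self]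
      exact (AddCircle.coe_eq_zero_iff 1).2 ⟨round r, by simp⟩
  have hn : ‖(v : UnitAddCircle)‖ = |v| := by
    rw [AddCircle.norm_coe_eq_abs_iff (p := 1) one_ne_zero, abs_one]
    exact hv
  rw [hn]
  have hc := cos_pi_mul_le (abs_nonneg v) hv
  have hc0 : 0 ≤ cos (π * |v|) := cos_nonneg_of_mem_Icc
    ⟨by nlinarith [pi_pos, abs_nonneg v], by nlinarith [pi_pos]⟩
  have e : cos (π * |v|) = cos (π * v) := by
    rw [← cos_abs (π * v), abs_mul, abs_of_pos pi_pos]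
  have hf : fourier 1 (v : UnitAddCircle) = Complex.exp ((2 * π * v : ℝ) * Complex.I) := by
    rw [fourier_coe_apply]
    congr 1
    push_cast
    ring
  have hsq : ‖1 + fourier 1 (v : UnitAddCircle)‖ ^ 2 = (2 * cos (π * |v|)) ^ 2 := by
    rw [hf, ← Complex.normSq_eq_norm_sq, Complex.normSq_apply]
    simp only [Complex.add_re, Complex.one_re, Complex.exp_ofReal_mul_I_re, Complex.add_im,
      Complex.one_im, Complex.exp_ofReal_mul_I_im, e]
    have h1 := cos_two_mul (π * v)
    rw [← mul_assoc] at h1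
    have h2 := sin_sq_add_cos_sq (2 * π * v)
    rw [h1] at h2 ⊢
    linarith
  have := (sq_eq_sq₀ (norm_nonneg _) (by positivity)).1 hsq
  linarith

/-- The vectors with entries in `{-1, 0, 1}` and support in `S`. -/
def signVectors {d : ℕ} (S : Finset (Fin d)) : Finset (Fin d → ℤ) :=
  Fintype.piFinset fun j => if j ∈ S then {-1, 0, 1} else {0}

theorem card_signVectors {d : ℕ} (S : Finset (Fin d)) : (signVectors S).card = 3 ^ S.card := by
  rw [signVectors, Fintype.card_piFinset]
  have : ∀ j, (if j ∈ S then ({-1, 0, 1} : Finset ℤ) else {0}).card = if j ∈ S then 3 else 1 :=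
    fun j => by split_ifs <;> rfl
  simp_rw [this]
  simp

theorem apply_of_mem_signVectors {d : ℕ} {S : Finset (Fin d)} {k : Fin d → ℤ}
    (hk : k ∈ signVectors S) (j : Fin d) :
    (k j : ℝ) ^ 2 ≤ if j ∈ S then 1 else 0 := by
  have := Fintype.mem_piFinset.1 hk j
  split_ifs at this ⊢ with h
  · simp only [Finset.mem_insert, Finset.mem_singleton] at this
    rcases this with h | h | h <;> simp [h]
  · simp only [Finset.mem_singleton] at this
    simp [this]

theorem apply_eq_zero_of_mem_signVectors {d : ℕ} {S : Finset (Fin d)} {k : Fin d → ℤ}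
    (hk : k ∈ signVectors S) {j : Fin d} (hj : j ∉ S) : k j = 0 := by
  simpa [hj] using Fintype.mem_piFinset.1 hk j

/-- Take sign vectors supported on m coordinates other than i: their squared norm is at most m, so
the shift by e_i stays in the ball, and coordinate i separates the two sets. -/
theorem exists_disjoint_pairs {d N m : ℕ} (hm : m + 1 ≤ d) (hmN : m + 1 ≤ N ^ 2) (i : Fin d) :
    ∃ F : Finset (Fin d → ℤ), F.card = 3 ^ m ∧ Disjoint F (F.image (· + Pi.single i 1)) ∧
      F ∪ F.image (· + Pi.single i 1) ⊆ freqBall d N := by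
  obtain ⟨S, hS, hcard⟩ := Finset.exists_subset_card_eq
    (s := (Finset.univ : Finset (Fin d)).erase i) (n := m)
    (by rw [Finset.card_erase_of_mem (Finset.mem_univ i), Finset.card_univ, Fintype.card_fin]; omega)
  have hiS : i ∉ S := fun h => Finset.ne_of_mem_erase (hS h) rfl
  have hmN' : (m : ℝ) + 1 ≤ (N : ℝ) ^ 2 := by exact_mod_cast hmN
  refine ⟨signVectors S, by rw [card_signVectors, hcard], ?_, ?_⟩
  · rw [Finset.disjoint_right]
    intro k hk hk'
    obtain ⟨l, hl, rfl⟩ := Finset.mem_image.1 hk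
    have h1 := apply_eq_zero_of_mem_signVectors hk' hiS
    have h2 := apply_eq_zero_of_mem_signVectors hl hiS
    simp [h2] at h1
  · have hsum : ∑ j, (if j ∈ S then (1 : ℝ) else 0) = m := by
      simp [Finset.sum_ite_mem, hcard]
    refine Finset.union_subset (fun k hk => ?_) fun k hk => ?_
    · rw [mem_freqBall]
      refine (Finset.sum_le_sum fun j _ => apply_of_mem_signVectors hk j).trans ?_
      rw [hsum]; linarith
    · obtain ⟨l, hl, rfl⟩ := Finset.mem_image.1 hk
      rw [mem_freqBall]
      have : ∀ j, (((l + Pi.single i 1 : Fin d → ℤ) j : ℤ) : ℝ) ^ 2 ≤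
          (if j ∈ S then (1 : ℝ) else 0) + if j = i then 1 else 0 := by
        intro j
        rcases eq_or_ne j i with rfl | hj
        · simp [apply_eq_zero_of_mem_signVectors hl hiS, hiS]
        · simpa [hj] using apply_of_mem_signVectors hl j
      refine (Finset.sum_le_sum fun j _ => this j).trans ?_
      rw [Finset.sum_add_distrib, hsum, Finset.sum_ite_eq' Finset.univ i]
      simpa using hmN'

theorem card_freqBall_ge {d N m : ℕ} (hm : m + 1 ≤ d) (hmN : m + 1 ≤ N ^ 2) :
    2 * 3 ^ m ≤ (freqBall d N).card := by
  obtain ⟨F, hF, hdis, hsub⟩ := exists_disjoint_pairs hm hmN ⟨0, by omega⟩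
  have := Finset.card_le_card hsub
  rw [Finset.card_union_of_disjoint hdis, Finset.card_image_of_injective _ (add_left_injective _),
    hF] at this
  omega

/-- The Dirichlet kernel of the ball is bounded away from its value at the origin. -/
theorem norm_sum_mFourier_le {d N m : ℕ} (hm : m + 1 ≤ d) (hmN : m + 1 ≤ N ^ 2)
    (x : UnitAddTorus (Fin d)) :
    ‖∑ k ∈ freqBall d N, mFourier k x‖ ≤ (freqBall d N).card - 8 * 3 ^ m * ‖x‖ ^ 2 := by
  obtain ⟨i, hi⟩ := exists_norm_apply_eq (by omega) x
  -- With the shift along a maximal coordinate, each of the 3^m pairs falls short of its trivial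
  -- bound 2 by at least 8‖x‖².
  obtain ⟨F, hF, hdis, hsub⟩ := exists_disjoint_pairs hm hmN i
  have hnorm : ∀ k : Fin d → ℤ, ‖mFourier k x‖ ≤ 1 := fun k =>
    ((mFourier k).norm_coe_le_norm x).trans_eq mFourier_norm
  have hinj : Function.Injective fun k : Fin d → ℤ => k + Pi.single i 1 := add_left_injective _
  rw [← Finset.sum_sdiff hsub, Finset.sum_union hdis, Finset.sum_image hinj.injOn,
    ← Finset.sum_add_distrib]
  have h1 : ∀ k : Fin d → ℤ, ‖mFourier k x + mFourier (k + Pi.single i 1) x‖ ≤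
      2 * (1 - 4 * ‖x‖ ^ 2) := fun k => by
    rw [mFourier_add, mFourier_single, ← hi]
    calc _ = ‖mFourier k x‖ * ‖1 + fourier 1 (x i)‖ := by rw [← norm_mul]; ring_nf
      _ ≤ 1 * ‖1 + fourier 1 (x i)‖ := by gcongr; exact hnorm k
      _ ≤ _ := by rw [one_mul]; exact norm_one_add_fourier_le _
  have h2 := Finset.card_sdiff_add_card_eq_card hsub
  rw [Finset.card_union_of_disjoint hdis, Finset.card_image_of_injective _ hinj, hF] at h2
  have h3 : (((freqBall d N) \ (F ∪ F.image (· + Pi.single i 1))).card : ℝ) + (3 ^ m + 3 ^ m) =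
      (freqBall d N).card := by exact_mod_cast h2
  have h4 := norm_sum_le_of_le ((freqBall d N) \ (F ∪ F.image (· + Pi.single i 1)))
    (f := fun k => mFourier k x) (n := fun _ => (1 : ℝ)) fun k _ => hnorm k
  have h5 := norm_sum_le_of_le F (f := fun k => mFourier k x + mFourier (k + Pi.single i 1) x)
    fun k _ => h1 k
  rw [Finset.sum_const, nsmul_eq_mul, mul_one] at h4
  rw [Finset.sum_const, nsmul_eq_mul, hF] at h5
  push_cast at h5
  refine (norm_add_le _ _).trans ((add_le_add h4 h5).trans ?_)
  linarith

/-- If d ≤ N², the base is at most 3. Otherwise, with u = 1/q, (3/2)u ≤ 1 + u² ≤ exp(u²), and u²d =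
N² gives e^{N²} ≤ 3^{N²}. -/
theorem three_halves_div_pow_le {d N : ℕ} {q : ℝ} (hq : 1 / 2 < q) (hqN : q ^ 2 * N ^ 2 = d) :
    (3 / 2 / q) ^ d ≤ 3 ^ min (N ^ 2) d := by
  have hq0 : 0 < q := by linarith
  rcases le_total d (N ^ 2) with h | h
  · rw [min_eq_right h]
    refine pow_le_pow_left₀ (by positivity) ?_ d
    rw [div_le_iff₀ hq0]; linarith
  · rw [min_eq_left h]
    have h1 : 3 / 2 / q ≤ exp ((1 / q) ^ 2) := by
      refine le_trans ?_ (add_one_le_exp _)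
      have : 3 / 2 / q = 3 / 2 * (1 / q) := by ring
      rw [this]
      nlinarith [sq_nonneg (1 / q - 1), one_div_pos.2 hq0]
    calc (3 / 2 / q) ^ d ≤ exp ((1 / q) ^ 2) ^ d := pow_le_pow_left₀ (by positivity) h1 d
      _ = exp 1 ^ (N ^ 2) := by
        rw [← exp_nat_mul, ← exp_nat_mul, ← hqN]
        congr 1
        push_cast
        field_simp
      _ ≤ 3 ^ (N ^ 2) := pow_le_pow_left₀ (exp_pos 1).le exp_one_lt_three.le _

theorem le_sigmaMin_of_half_lt {d N : ℕ} (hd : 2 ≤ d) (hN : 1 ≤ N)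
    {Y : Finset (UnitAddTorus (Fin d))} (hY : Y.Nonempty)
    {C : Set (Set (UnitAddTorus (Fin d)))} {q' q : ℝ}
    (hC : IsPairClustering q' (Y : Set (UnitAddTorus (Fin d))) C) {τ : ℝ} (hτ : 0 ≤ τ)
    (hqN : q ^ 2 * N ^ 2 = d) (hq2 : 1 / 2 < q) (hτq : τ ≤ q)
    (hsep : ENNReal.ofReal τ ≤ (Y : Set (UnitAddTorus (Fin d))).einfsep)
    (hΔ : ENNReal.ofReal (2 * q) ≤ clusterSep C) {b : ℝ}
    (hb : b ^ 2 ≤ (3 / 2 / q) ^ d * (2 / 3) * ((d - 1 / 2) / d) * (τ / q) ^ 2) :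
    b ≤ sigmaMin (vandermondeMatrix N Y) := by
  have hd' : (2 : ℝ) ≤ d := by exact_mod_cast hd
  have hq0 : 0 < q := by linarith
  -- The largest m allowed by `exists_disjoint_pairs`; the factor 2/3 in the bound then turns
  -- 3^(m+1) into 2·3^m.
  obtain ⟨m, hm⟩ : ∃ m, min (N ^ 2) d = m + 1 :=
    Nat.exists_eq_succ_of_ne_zero (by
      have : 0 < N ^ 2 := by positivity
      omega)
  have hmd : m + 1 ≤ d := hm ▸ min_le_right _ _
  have hmN : m + 1 ≤ N ^ 2 := hm ▸ min_le_left _ _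
  have hb' : b ^ 2 ≤ 2 * 3 ^ m * (τ / q) ^ 2 := by
    have h1 := three_halves_div_pow_le hq2 hqN
    have h2 : (d - 1 / 2 : ℝ) / d ≤ 1 := by rw [div_le_one (by linarith)]; linarith
    rw [hm, pow_succ] at h1
    refine hb.trans (mul_le_mul_of_nonneg_right ?_ (sq_nonneg _))
    have h3 : 0 ≤ (3 / 2 / q) ^ d * (2 / 3) := by positivity
    refine (mul_le_of_le_one_right h3 h2).trans ?_
    linarith
  have hsmall : b ^ 2 ≤ 8 * 3 ^ m * τ ^ 2 := by
    refine hb'.trans ?_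
    have h1 : (τ / q) ^ 2 ≤ 4 * τ ^ 2 := by
      have : τ / q ≤ 2 * τ := by
        rw [div_le_iff₀ hq0]; nlinarith
      calc (τ / q) ^ 2 ≤ (2 * τ) ^ 2 := pow_le_pow_left₀ (by positivity) this 2
        _ = _ := by ring
    have h2 : (0 : ℝ) ≤ 2 * 3 ^ m := by positivity
    nlinarith [mul_le_mul_of_nonneg_left h1 h2]
  have hcard : b ^ 2 ≤ (freqBall d N).card := by
    have h1 : (τ / q) ^ 2 ≤ 1 := pow_le_one₀ (by positivity) (by rwa [div_le_one hq0])
    have h2 : ((2 * 3 ^ m : ℕ) : ℝ) ≤ (freqBall d N).card := by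
      exact_mod_cast card_freqBall_ge hmd hmN
    push_cast at h2
    exact (hb'.trans (mul_le_of_le_one_right (by positivity) h1)).trans h2
  refine le_sigmaMin_vandermondeMatrix hY (w := fun k => if k ∈ freqBall d N then 1 else 0)
    (W := fun x => ∑ k ∈ freqBall d N, mFourier k x) (W0 := (freqBall d N).card) (fun x => ?_)
    (fun k hk => by simp [hk]) (fun k hk => by simp [hk]) ?_ fun t ht => ?_
  · have := hasSum_sum_of_ne_finset_zero (L := .unconditional _) (s := freqBall d N)
      (f := fun k => (((if k ∈ freqBall d N then 1 else 0 : ℝ)) : ℂ) * mFourier k x)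
      fun k hk => by simp [hk]
    rwa [Finset.sum_congr rfl fun k hk => by rw [if_pos hk, Complex.ofReal_one, one_mul]] at this
  · have : ∀ k : Fin d → ℤ, mFourier k (0 : UnitAddTorus (Fin d)) = 1 := fun k => by
      simp [mFourier]
    simp [this]
  · refine sum_norm_le_of_isPairClustering hC (W := fun x => ∑ k ∈ freqBall d N, mFourier k x)
      (by linarith) (fun t ht t' ht' hne => ?_) (fun Λ₁ h1 Λ₂ h2 hne t ht t' ht' => ?_) ht
    · refine (norm_sum_mFourier_le hmd hmN _).trans (sub_le_sub_left (hsmall.trans ?_) _)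
      have := le_norm_of_le_einfsep hsep ht ht' hne
      gcongr
    -- Two clusters cannot exist: distances in the torus are at most 1/2, while 2q > 1.
    · exfalso
      have h3 := le_dist_of_le_clusterSep hΔ h1 h2 hne ht ht'
      obtain ⟨i, hi⟩ := exists_norm_apply_eq (by omega) (t' - t)
      have h4 := AddCircle.norm_le_half_period (1 : ℝ) one_ne_zero (x := (t' - t) i)
      rw [hi, abs_one] at h4
      linarith

/-- With q = √d/N, the square of the claimed bound is exactly the drop in `kernel_le` at distance τ
≤ q. -/
theorem bound_sq {d N : ℕ} (hd : 2 ≤ d) (hN : 1 ≤ N) {τ : ℝ} :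
    (√(((d : ℝ) - 1 / 2) / (3 * (d : ℝ) ^ 2)) * (3 / 2 : ℝ) ^ ((d : ℝ) / 2) *
        (((N : ℝ) * τ) * (N : ℝ) ^ ((d : ℝ) / 2) /
          ((2 : ℝ) ^ (-(1 / 2) : ℝ) * (d : ℝ) ^ ((d : ℝ) / 4)))) ^ 2 =
      (3 / 2 / (√(d : ℝ) / N)) ^ d * (2 / 3) * ((d - 1 / 2) / d) * (τ / (√(d : ℝ) / N)) ^ 2 := by
  have hd' : (2 : ℝ) ≤ d := by exact_mod_cast hd
  have hd0 : (0 : ℝ) < d := by linarith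
  have hN' : (0 : ℝ) < N := by exact_mod_cast hN
  have e1 : ∀ a : ℝ, 0 ≤ a → (a ^ ((d : ℝ) / 2)) ^ 2 = a ^ d := fun a ha => by
    rw [← rpow_natCast, ← rpow_mul ha, ← rpow_natCast a d]; congr 1; push_cast; ring
  have e2 : ((d : ℝ) ^ ((d : ℝ) / 4)) ^ 2 = √(d : ℝ) ^ d := by
    rw [sqrt_eq_rpow, ← rpow_natCast, ← rpow_natCast, ← rpow_mul hd0.le, ← rpow_mul hd0.le]
    congr 1; push_cast; ring
  have e3 : ((2 : ℝ) ^ (-(1 / 2) : ℝ)) ^ 2 = 1 / 2 := by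
    rw [← rpow_natCast, ← rpow_mul zero_le_two]
    norm_num [rpow_neg_one]
  have hs : 0 < √(d : ℝ) := sqrt_pos.2 hd0
  have hs2 : √(d : ℝ) ^ 2 = d := sq_sqrt hd0.le
  rw [mul_pow, mul_pow, div_pow, mul_pow, mul_pow, mul_pow, e1 _ (by norm_num), e1 _ hN'.le, e2, e3,
    sq_sqrt (div_nonneg (by linarith) (by positivity)), div_div_eq_mul_div, div_pow (3 / 2 * (N : ℝ)),
    mul_pow, div_div_eq_mul_div, div_pow (τ * N), hs2]
  field_simp

end Vandermonde

theorem mainTheorem5 (d N : ℕ) (hd : 2 ≤ d) (hN : 1 ≤ N)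
    (Y : Finset (UnitAddTorus (Fin d))) (hY : Y.Nonempty)
    (C : Set (Set (UnitAddTorus (Fin d))))
    (hC : Vandermonde.IsPairClustering (√(d : ℝ) / N) (Y : Set (UnitAddTorus (Fin d))) C)
    (τ : ℝ) (hτ_pos : 0 < τ) (hτ_lt : τ < √(d : ℝ) / N)
    (hsep : ENNReal.ofReal τ ≤ (Y : Set (UnitAddTorus (Fin d))).einfsep)
    (hΔ : ENNReal.ofReal (2 * √(d : ℝ) / N) ≤ Vandermonde.clusterSep C) :
    √(((d : ℝ) - 1 / 2) / (3 * (d : ℝ) ^ 2)) * (3 / 2 : ℝ) ^ ((d : ℝ) / 2) *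
        (((N : ℝ) * τ) * (N : ℝ) ^ ((d : ℝ) / 2) /
          ((2 : ℝ) ^ (-(1 / 2) : ℝ) * (d : ℝ) ^ ((d : ℝ) / 4))) ≤
      Vandermonde.sigmaMin (Vandermonde.vandermondeMatrix N Y) := by
  have hN' : (0 : ℝ) < N := by exact_mod_cast hN
  have hd' : (0 : ℝ) < d := by positivity
  have hq : 0 < √(d : ℝ) / N := by positivity
  have hqN : (√(d : ℝ) / N) ^ 2 * N ^ 2 = d := by
    rw [div_pow, Real.sq_sqrt hd'.le]; field_simp
  have hb := (Vandermonde.bound_sq (τ := τ) hd hN).le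
  rw [mul_div_assoc] at hΔ
  rcases le_or_gt (√(d : ℝ) / N) (1 / 2) with h | h
  · exact Vandermonde.le_sigmaMin_of_le_half hd hN hY hC hτ_pos.le hq hqN h hτ_lt.le hsep
      ((ENNReal.ofReal_le_ofReal (by linarith)).trans hΔ) hb
  · exact Vandermonde.le_sigmaMin_of_half_lt hd hN hY hC hτ_pos.le hqN h hτ_lt.le hsep hΔ hb
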